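/- Let $X$ be a metric space that is uniformly locally finite (ulf), i.e. $\sup_{x\in X}|\{y\in X: d(x,y)\le R\}|<\infty$ for every $R>0$. For $A\subset X$ let $1_A$ be the orthogonal projection of the complex Hilbert space $\ell_2X$ onto $\ell_2A$, and for $A,B\subset X$ let $d(A,B)=\inf\{d(a,b):a\in A,\ b\in B\}$ (with $\inf\emptyset=\infty$). A bounded operator $u$ on $\ell_2X$ has finite propagation if there is $R>0$ such that $\langle u\delta_x,\delta_y\rangle=0$ whenever $d(x,y)>R$; it is quasi-local if for every $\varepsilon>0$ there is $R>0$ such that $\|1_Au1_B\|\le\varepsilon$ whenever $A,B\subset X$ satisfy $d(A,B)>R$. The uniform Roe algebra $\mathrm{C}^*_u[X]$ is the norm closure in $\mathbb{B}(\ell_2X)$ of the $*$-algebra of finite propagation operators, and the quasi-local algebra $\mathrm{C}^*_{ql}[X]$ is the $\mathrm{C}^*$-algebra of all quasi-local operators. Suppose that $X$ contains a sequence of expanders: there are finite subsets $X_n\subset X$ ($n\in\mathbb{N}$), equipped with the metric of $X$, such that $|X_n|\to\infty$ and, for some $R>0$, $$\inf_n\ \min_{\substack{A\subset X_n\\ 0<|A|/|X_n|\le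 1/2}}\ \frac{|\{x\in X_n: d(x,A)\le R\}|}{|A|}>1$$ (the minimum over an empty family being $+\infty$). Then the inclusion $\mathrm{C}^*_u[X]\subset\mathrm{C}^*_{ql}[X]$ is proper. In other words, there is a quasi-local operator on $\ell_2X$ that is not a norm limit of finite propagation operators. -/

import Mathlib

open scoped InnerProductSpace

namespace RoeAlgebra

noncomputable section

/-- A metric space is *uniformly locally finite* (ulf) if for every `R > 0` there is a finite
upper bound for the cardinalities of all closed balls of radius `R`. -/
def IsULF (X : Type*) [MetricSpace X] : Prop :=
  ∀ R : ℝ, 0 < R → ∃ N : ℕ, ∀ x : X, (Metric.closedBall x R).encard ≤ (N : ℕ∞)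

/-- The complex Hilbert space `ℓ₂X`. -/
abbrev L2 (X : Type*) : Type _ := lp (fun _ : X => ℂ) 2

/-- The bounded operators on `ℓ₂X`. -/
abbrev Op (X : Type*) : Type _ := L2 X →L[ℂ] L2 X

section Basics

variable {X : Type*}

open scoped Classical in
/-- The canonical basis vector `δ_x` of `ℓ₂X`. -/
def delta (x : X) : L2 X := lp.single 2 x (1 : ℂ)

theorem inner_delta_left (x : X) (f : L2 X) : ⟪delta x, f⟫_ℂ = f x := by
  classical
  rw [delta, lp.inner_single_left]
  simp

theorem inner_delta_right (x : X) (f : L2 X) : ⟪f, delta x⟫_ℂ = star (f x) := by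
  rw [← inner_conj_symm, inner_delta_left]
  rfl

/-- The restriction of a vector `f ∈ ℓ₂X` to a subset `A ⊆ X`. -/
def restrict (A : Set X) (f : L2 X) : L2 X :=
  ⟨A.indicator (f : ∀ _ : X, ℂ), by
    refine Memℓp.of_norm (f := A.indicator (f : ∀ _ : X, ℂ)) ?_
    have h := (lp.memℓp f).norm
    refine Memℓp.mono' h fun x => ?_
    by_cases hx : x ∈ A <;> simp [hx]⟩

theorem restrict_apply (A : Set X) (f : L2 X) (x : X) :
    restrict A f x = A.indicator (f : ∀ _ : X, ℂ) x := rfl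

theorem norm_restrict_le (A : Set X) (f : L2 X) : ‖restrict A f‖ ≤ ‖f‖ := by
  refine lp.norm_mono (by norm_num) fun x => ?_
  rw [restrict_apply]
  by_cases hx : x ∈ A <;> simp [hx]

/-- The orthogonal projection `1_A` from `ℓ₂X` onto `ℓ₂A`, for `A ⊆ X`. -/
def proj (A : Set X) : Op X :=
  LinearMap.mkContinuous
    { toFun := restrict A
      map_add' := fun f g => by
        ext x
        change A.indicator ((f : ∀ _ : X, ℂ) + (g : ∀ _ : X, ℂ)) x = _
        rw [Set.indicator_add']
        rfl
      map_smul' := fun c f => by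
        ext x
        by_cases hx : x ∈ A <;> simp [restrict_apply, hx] }
    1 (fun f => by simpa using norm_restrict_le A f)

theorem proj_apply (A : Set X) (f : L2 X) (x : X) :
    proj A f x = A.indicator (f : ∀ _ : X, ℂ) x := rfl

theorem norm_proj_le (A : Set X) : ‖proj A‖ ≤ 1 :=
  LinearMap.mkContinuous_norm_le _ zero_le_one _

theorem star_proj (A : Set X) : star (proj A) = proj A := by
  rw [ContinuousLinearMap.star_eq_adjoint]
  symm
  rw [ContinuousLinearMap.eq_adjoint_iff]
  intro f g
  rw [lp.inner_eq_tsum, lp.inner_eq_tsum]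
  refine tsum_congr fun x => ?_
  by_cases hx : x ∈ A <;> simp [proj_apply, hx]

theorem proj_mul_proj_of_disjoint {A B : Set X} (h : Disjoint A B) :
    proj A * proj B = 0 := by
  ext f x
  change A.indicator (B.indicator (f : ∀ _ : X, ℂ)) x = 0
  rw [Set.indicator_indicator, Set.disjoint_iff_inter_eq_empty.mp h, Set.indicator_empty]

theorem proj_add_proj_compl (C : Set X) : proj C + proj Cᶜ = 1 := by
  ext f x
  change C.indicator (f : ∀ _ : X, ℂ) x + Cᶜ.indicator (f : ∀ _ : X, ℂ) x = f x
  by_cases hx : x ∈ C <;> simp [hx]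

end Basics

section Propagation

variable {X : Type*} [MetricSpace X]

/-- `u` has *propagation at most `R`*: `⟨u δ_x, δ_y⟩ = 0` whenever `dist x y > R`. -/
def PropagationLE (R : ℝ) (u : Op X) : Prop :=
  ∀ x y : X, R < dist x y → ⟪u (delta x), delta y⟫_ℂ = 0

/-- `u` is a finite propagation operator: it belongs to the union over `R > 0` of the sets of
operators with propagation at most `R`. -/
def HasFinitePropagation (u : Op X) : Prop :=
  ∃ R : ℝ, 0 < R ∧ PropagationLE R u

/-- The distance between two subsets, `inf {dist a b : a ∈ A, b ∈ B}`, which is `∞` if one of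
them is empty. -/
def setDist (A B : Set X) : ENNReal := ⨅ a ∈ A, ⨅ b ∈ B, edist a b

/-- `u` has *`ε`-propagation at most `R`*: `‖1_A u 1_B‖ ≤ ε` whenever `dist(A, B) > R`. -/
def EpsPropagationLE (ε R : ℝ) (u : Op X) : Prop :=
  ∀ A B : Set X, ENNReal.ofReal R < setDist A B → ‖proj A * u * proj B‖ ≤ ε

/-- `u` is *quasi-local*: it has finite `ε`-propagation for every `ε > 0`. -/
def IsQuasiLocal (u : Op X) : Prop :=
  ∀ ε : ℝ, 0 < ε → ∃ R : ℝ, 0 < R ∧ EpsPropagationLE ε R u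

theorem setDist_comm (A B : Set X) : setDist A B = setDist B A := by
  unfold setDist
  rw [iInf₂_comm]
  simp_rw [edist_comm]

theorem setDist_le {A B : Set X} {a b : X} (ha : a ∈ A) (hb : b ∈ B) :
    setDist A B ≤ edist a b :=
  (iInf₂_le a ha).trans (iInf₂_le b hb)

theorem le_setDist {A B : Set X} {r : ENNReal} (h : ∀ a ∈ A, ∀ b ∈ B, r ≤ edist a b) :
    r ≤ setDist A B :=
  le_iInf₂ fun a ha => le_iInf₂ fun b hb => h a ha b hb

theorem disjoint_of_lt_setDist {A B : Set X} {r : ENNReal} (h : r < setDist A B) :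
    Disjoint A B := by
  rw [Set.disjoint_left]
  intro x hA hB
  have := h.trans_le (setDist_le hA hB)
  simp at this

theorem PropagationLE.mono {R S : ℝ} {u : Op X} (h : PropagationLE R u) (hRS : R ≤ S) :
    PropagationLE S u :=
  fun x y hxy => h x y (hRS.trans_lt hxy)

theorem EpsPropagationLE.mono {ε R S : ℝ} {u : Op X} (h : EpsPropagationLE ε R u)
    (hRS : R ≤ S) : EpsPropagationLE ε S u :=
  fun A B hAB => h A B ((ENNReal.ofReal_le_ofReal hRS).trans_lt hAB)

theorem PropagationLE.star {R : ℝ} {u : Op X} (h : PropagationLE R u) :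
    PropagationLE R (star u) := by
  intro x y hxy
  rw [ContinuousLinearMap.star_eq_adjoint, ContinuousLinearMap.adjoint_inner_left,
    ← inner_conj_symm, h y x (by rwa [dist_comm]), map_zero]

theorem PropagationLE.mul {R S : ℝ} {u v : Op X} (hu : PropagationLE R u)
    (hv : PropagationLE S v) : PropagationLE (R + S) (u * v) := by
  intro x y hxy
  rw [mul_apply_eq_comp, ← ContinuousLinearMap.adjoint_inner_right,
    lp.inner_eq_tsum]
  refine (tsum_congr fun z => ?_).trans tsum_zero
  by_cases hz : S < dist x z
  · have h1 : (v (delta x)) z = 0 := by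
      have := hv x z hz
      rw [inner_delta_right] at this
      simpa using this
    rw [h1, inner_zero_left]
  · have h2 : R < dist y z := by
      have := dist_triangle x z y
      rw [dist_comm y z]
      linarith
    have h3 : (ContinuousLinearMap.adjoint u (delta y)) z = 0 := by
      have := hu.star y z h2
      rw [inner_delta_right, ContinuousLinearMap.star_eq_adjoint] at this
      simpa using this
    rw [h3, inner_zero_right]

variable (X)

/-- The `*`-algebra of finite propagation operators on `ℓ₂X`. -/
def finitePropagationAlgebra : StarSubalgebra ℂ (Op X) where
  carrier := {u | HasFinitePropagation u}
  mul_mem' := by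
    rintro u v ⟨R, hR, hu⟩ ⟨S, hS, hv⟩
    exact ⟨R + S, by positivity, hu.mul hv⟩
  add_mem' := by
    rintro u v ⟨R, hR, hu⟩ ⟨S, hS, hv⟩
    refine ⟨max R S, lt_max_of_lt_left hR, fun x y hxy => ?_⟩
    rw [add_apply, inner_add_left,
      hu.mono (le_max_left R S) x y hxy, hv.mono (le_max_right R S) x y hxy, add_zero]
  algebraMap_mem' := by
    intro c
    refine ⟨1, one_pos, fun x y hxy => ?_⟩
    have hne : y ≠ x := by
      rintro rfl
      rw [dist_self] at hxy
      linarith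
    rw [inner_delta_right, Algebra.algebraMap_eq_smul_one]
    simp [delta, hne]
  star_mem' := by
    rintro u ⟨R, hR, hu⟩
    exact ⟨R, hR, hu.star⟩

/-- The *uniform Roe algebra* `C*_u[X]`: the norm closure in `B(ℓ₂X)` of the `*`-algebra of
finite propagation operators. -/
def uniformRoeAlgebra : StarSubalgebra ℂ (Op X) :=
  (finitePropagationAlgebra X).topologicalClosure

variable {X}

theorem EpsPropagationLE.star {ε R : ℝ} {u : Op X} (h : EpsPropagationLE ε R u) :
    EpsPropagationLE ε R (star u) := by
  intro A B hAB
  have h1 := h B A (by rwa [setDist_comm])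
  have h2 : proj A * Star.star u * proj B = Star.star (proj B * u * proj A) := by
    rw [star_mul, star_mul, star_proj, star_proj, mul_assoc]
  rw [h2, ContinuousLinearMap.star_eq_adjoint]
  exact (LinearIsometryEquiv.norm_map ContinuousLinearMap.adjoint _).trans_le h1

theorem IsQuasiLocal.mul {u v : Op X} (hu : IsQuasiLocal u) (hv : IsQuasiLocal v) :
    IsQuasiLocal (u * v) := by
  intro ε hε
  have hK : 0 < ‖u‖ + ‖v‖ + 1 := by positivity
  obtain ⟨R, hR, hu⟩ := hu (ε / (‖u‖ + ‖v‖ + 1)) (by positivity)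
  obtain ⟨S, hS, hv⟩ := hv (ε / (‖u‖ + ‖v‖ + 1)) (by positivity)
  refine ⟨(R + 1) + (S + 1), by positivity, fun A B hAB => ?_⟩
  set C : Set X := {x | Metric.infEDist x A < ENNReal.ofReal (R + 1)} with hC
  have hAC : ENNReal.ofReal R < setDist A Cᶜ := by
    refine lt_of_lt_of_le ?_ (le_setDist (r := ENNReal.ofReal (R + 1)) fun a ha c hc => ?_)
    · rw [ENNReal.ofReal_lt_ofReal_iff (by positivity)]
      linarith
    · rw [hC, Set.mem_compl_iff, Set.mem_ofPred_eq, not_lt] at hc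
      rw [edist_comm]
      exact hc.trans (Metric.infEDist_le_edist_of_mem ha)
  have hCB : ENNReal.ofReal S < setDist C B := by
    refine lt_of_lt_of_le ?_ (le_setDist (r := ENNReal.ofReal (S + 1)) fun c hc b hb => ?_)
    · rw [ENNReal.ofReal_lt_ofReal_iff (by positivity)]
      linarith
    · obtain ⟨a, ha, hac⟩ := Metric.infEDist_lt_iff.mp hc
      have h1 := hAB.trans_le ((setDist_le ha hb).trans (edist_triangle a c b))
      rw [edist_dist, edist_dist, ← ENNReal.ofReal_add dist_nonneg dist_nonneg,
        ENNReal.ofReal_lt_ofReal_iff_of_nonneg (by positivity)] at h1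
      rw [edist_dist, ENNReal.ofReal_lt_ofReal_iff (by positivity), dist_comm] at hac
      rw [edist_dist]
      exact ENNReal.ofReal_le_ofReal (by linarith)
  have hsplit : proj A * (u * v) * proj B =
      (proj A * u) * (proj C * v * proj B) + (proj A * u * proj Cᶜ) * (v * proj B) := by
    calc proj A * (u * v) * proj B
        = proj A * u * (proj C + proj Cᶜ) * v * proj B := by
          rw [proj_add_proj_compl, mul_one, mul_assoc (proj A) u v]
      _ = _ := by noncomm_ring
  have e1 : ‖proj A * u‖ ≤ ‖u‖ := (norm_mul_le _ _).trans
    (mul_le_of_le_one_left (norm_nonneg _) (norm_proj_le A))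
  have e2 : ‖v * proj B‖ ≤ ‖v‖ := (norm_mul_le _ _).trans
    (mul_le_of_le_one_right (norm_nonneg _) (norm_proj_le B))
  calc ‖proj A * (u * v) * proj B‖
      ≤ ‖proj A * u‖ * ‖proj C * v * proj B‖ + ‖proj A * u * proj Cᶜ‖ * ‖v * proj B‖ := by
        rw [hsplit]
        exact (norm_add_le _ _).trans (add_le_add (norm_mul_le _ _) (norm_mul_le _ _))
    _ ≤ ‖u‖ * (ε / (‖u‖ + ‖v‖ + 1)) + (ε / (‖u‖ + ‖v‖ + 1)) * ‖v‖ := by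
        gcongr
        · exact hv C B hCB
        · exact hu A Cᶜ hAC
    _ = ε * ((‖u‖ + ‖v‖) / (‖u‖ + ‖v‖ + 1)) := by ring
    _ ≤ ε := mul_le_of_le_one_right hε.le ((div_le_one hK).mpr (by linarith))

theorem IsQuasiLocal.add {u v : Op X} (hu : IsQuasiLocal u) (hv : IsQuasiLocal v) :
    IsQuasiLocal (u + v) := by
  intro ε hε
  obtain ⟨R, hR, hu⟩ := hu (ε / 2) (by positivity)
  obtain ⟨S, hS, hv⟩ := hv (ε / 2) (by positivity)
  refine ⟨max R S, lt_max_of_lt_left hR, fun A B hAB => ?_⟩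
  have h1 := hu.mono (le_max_left R S) A B hAB
  have h2 := hv.mono (le_max_right R S) A B hAB
  rw [mul_add, add_mul]
  exact (norm_add_le _ _).trans (by linarith)

variable (X)

/-- The *quasi-local algebra* `C*_ql[X]`, consisting of all quasi-local operators on `ℓ₂X`. -/
def quasiLocalAlgebra : StarSubalgebra ℂ (Op X) where
  carrier := {u | IsQuasiLocal u}
  mul_mem' := fun hu hv => IsQuasiLocal.mul hu hv
  add_mem' := fun hu hv => IsQuasiLocal.add hu hv
  algebraMap_mem' := by
    intro c ε hε
    refine ⟨1, one_pos, fun A B hAB => ?_⟩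
    rw [Algebra.algebraMap_eq_smul_one, mul_smul_comm, mul_one, smul_mul_assoc,
      proj_mul_proj_of_disjoint (disjoint_of_lt_setDist hAB), smul_zero, norm_zero]
    exact hε.le
  star_mem' := by
    intro u hu ε hε
    obtain ⟨R, hR, h⟩ := hu ε hε
    exact ⟨R, hR, h.star⟩

end Propagation

section Expanders

/-- A sequence `(Y n)` of finite metric spaces is a *sequence of expanders* if `|Y n| → ∞` and
there is `R > 0` such that the infimum, over all `n` and all `A ⊆ Y n` with
`0 < |A| / |Y n| ≤ 1/2`, of the ratios `|{y ∈ Y n : dist(y, A) ≤ R}| / |A|` is larger than `1`,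
that is, these ratios have a lower bound `κ > 1`. -/
def IsExpanderSequence (Y : ℕ → Type*) [∀ n, MetricSpace (Y n)] [∀ n, Finite (Y n)] : Prop :=
  Filter.Tendsto (fun n => Nat.card (Y n)) Filter.atTop Filter.atTop ∧
    ∃ R : ℝ, 0 < R ∧ ∃ κ : ℝ, 1 < κ ∧ ∀ (n : ℕ) (A : Set (Y n)), A.Nonempty →
      (A.ncard : ℝ) / (Nat.card (Y n) : ℝ) ≤ 1 / 2 →
        κ ≤ ({y : Y n | Metric.infDist y A ≤ R}.ncard : ℝ) / (A.ncard : ℝ)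

/-- `X` *contains a sequence of expanders* if there is a sequence of finite subsets of `X` which
is a sequence of expanders for the metrics induced from `X`. -/
def ContainsExpanders (X : Type*) [MetricSpace X] : Prop :=
  ∃ Y : ℕ → Finset X, IsExpanderSequence (fun n => {x : X // x ∈ Y n})

end Expanders

end

end RoeAlgebra

/-! Inside the expanders one chooses disjoint finite blocks, each labelled by `m` copies of a sign
cube `{±1}^d`, and takes the `d` coordinate functions of the cube as orthonormal Rademacher vectors.

Quasi-locality. By Khintchine's inequality for fourth moments, the 2- and 4-norms are comparable on
the span of these vectors, so no vector of the span has much mass on a set occupying a small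
proportion of every block (`norm_proj_le_of_mem_space`). Expansion forces one of two distant sets to
be small in each block (`mixing_of_expanders`). Hence the projection onto the closed span of any
subfamily of Rademacher vectors is quasi-local (`isQuasiLocal_spaceProj`), and so is `signOp ε`, a
difference of two such projections, for every choice `ε` of signs.

Distance from finite propagation. Pair an operator `v` with the signs through `∑ i, ε i * ⟪r i, v (r
i)⟫`. On a block, `signOp ε` gives exactly `d`. If `v` has propagation at most `r`, only matrix
entries at distance at most `r` contribute; averaging over `ε` yields signs, chosen before `v`, for
which the pairing is at most `√(K * d) * ‖v‖`, where `K` bounds the cardinalities of balls of radius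
`r`. Thus `‖signOp ε - v‖ ≤ 1/2` forces `d ≤ 4 * K * ‖v‖ ^ 2` (`card_le_of_norm_signOp_sub_lt`).
Letting the dimensions outgrow the ball bounds along the blocks rules out every `v` at once. -/

namespace RoeAlgebra

noncomputable section

/-! ### Second and fourth moments of random sign sums -/

section Moments

/-- The sign `±1` attached to a Boolean. -/
def sgn (b : Bool) : ℂ := if b then 1 else -1

theorem norm_sgn (b : Bool) : ‖sgn b‖ = 1 := by
  cases b <;> simp [sgn]

theorem star_sgn (b : Bool) : star (sgn b) = sgn b := by
  cases b <;> simp [sgn]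

theorem sgn_mul_self (b : Bool) : sgn b * sgn b = 1 := by
  cases b <;> simp [sgn]

/-- The random sign sum `∑ i, c i * s i`. -/
def signSum {d : ℕ} (c : Fin d → ℂ) (s : Fin d → Bool) : ℂ := ∑ i, c i * sgn (s i)

theorem sum_signs_succ {M : Type*} [AddCommMonoid M] {d : ℕ} (F : (Fin (d + 1) → Bool) → M) :
    ∑ s, F s = ∑ s : Fin d → Bool, (F (Fin.cons true s) + F (Fin.cons false s)) := by
  rw [← (Fin.consEquiv fun _ => Bool).sum_comp, Fintype.sum_prod_type, Fintype.sum_bool,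
    ← Finset.sum_add_distrib]
  rfl

theorem signSum_cons {d : ℕ} (c : Fin (d + 1) → ℂ) (b : Bool) (s : Fin d → Bool) :
    signSum c (Fin.cons b s) = signSum (Fin.tail c) s + c 0 * sgn b := by
  simp [signSum, Fin.sum_univ_succ, Fin.tail, add_comm]

theorem sum_norm_sq_signSum {d : ℕ} (c : Fin d → ℂ) :
    ∑ s, ‖signSum c s‖ ^ 2 = 2 ^ d * ∑ i, ‖c i‖ ^ 2 := by
  induction d with
  | zero => simp [signSum]
  | succ d ih =>
    rw [sum_signs_succ]
    have h : ∀ s : Fin d → Bool,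
        ‖signSum c (Fin.cons true s)‖ ^ 2 + ‖signSum c (Fin.cons false s)‖ ^ 2 =
          2 * ‖signSum (Fin.tail c) s‖ ^ 2 + 2 * ‖c 0‖ ^ 2 := by
      intro s
      have := parallelogram_law_with_norm ℝ (signSum (Fin.tail c) s) (c 0)
      simp only [signSum_cons, sgn, if_true, Bool.false_eq_true, if_false, mul_one, mul_neg,
        ← sub_eq_add_neg]
      linear_combination this
    simp only [h, Finset.sum_add_distrib, ← Finset.mul_sum, ih, Fin.sum_univ_succ]
    simp [Fin.tail]
    ring

/-- The inductive step of the fourth moment bound: averaging over one further sign removes the odd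
cross terms. -/
theorem norm_add_pow_four_add_norm_sub_pow_four_le (z w : ℂ) :
    ‖z + w‖ ^ 4 + ‖z - w‖ ^ 4 ≤ 2 * ‖z‖ ^ 4 + 12 * ‖z‖ ^ 2 * ‖w‖ ^ 2 + 2 * ‖w‖ ^ 4 := by
  have h1 : ∀ a : ℂ, ‖a‖ ^ 4 = (a.re ^ 2 + a.im ^ 2) ^ 2 := by
    intro a
    rw [← Complex.normSq_add_mul_I a.re a.im, Complex.re_add_im, Complex.normSq_eq_norm_sq]
    ring
  have h2 : ∀ a : ℂ, ‖a‖ ^ 2 = a.re ^ 2 + a.im ^ 2 := by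
    intro a
    rw [← Complex.normSq_add_mul_I a.re a.im, Complex.re_add_im, Complex.normSq_eq_norm_sq]
  simp only [h1, h2, Complex.add_re, Complex.add_im, Complex.sub_re, Complex.sub_im]
  -- The two sides differ by eight times this square, by Lagrange's identity.
  nlinarith [sq_nonneg (z.re * w.im - z.im * w.re)]

/-- The fourth moment Khintchine inequality. -/
theorem sum_norm_pow_four_signSum_le {d : ℕ} (c : Fin d → ℂ) :
    ∑ s, ‖signSum c s‖ ^ 4 ≤ 3 * 2 ^ d * (∑ i, ‖c i‖ ^ 2) ^ 2 := by
  induction d with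
  | zero => simp [signSum]
  | succ d ih =>
    rw [sum_signs_succ]
    have h : ∀ s : Fin d → Bool,
        ‖signSum c (Fin.cons true s)‖ ^ 4 + ‖signSum c (Fin.cons false s)‖ ^ 4 ≤
          2 * ‖signSum (Fin.tail c) s‖ ^ 4 + 12 * ‖c 0‖ ^ 2 * ‖signSum (Fin.tail c) s‖ ^ 2
            + 2 * ‖c 0‖ ^ 4 := by
      intro s
      have := norm_add_pow_four_add_norm_sub_pow_four_le (signSum (Fin.tail c) s) (c 0)
      simp only [signSum_cons, sgn, if_true, Bool.false_eq_true, if_false, mul_one, mul_neg,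
        ← sub_eq_add_neg]
      linarith
    refine (Finset.sum_le_sum fun s _ => h s).trans ?_
    have ih := ih (Fin.tail c)
    simp only [Finset.sum_add_distrib, ← Finset.mul_sum, sum_norm_sq_signSum, Fin.sum_univ_succ,
      Finset.sum_const, Finset.card_univ, Fintype.card_fun, Fintype.card_bool, Fintype.card_fin,
      nsmul_eq_mul, Fin.tail] at ih ⊢
    push_cast
    set σ : ℝ := ∑ i : Fin d, ‖c i.succ‖ ^ 2
    -- After the induction hypothesis is used, the slack is four times this quantity.
    have h0 : (0 : ℝ) ≤ 2 ^ d * ‖c 0‖ ^ 4 := by positivity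
    have h1 : (2 : ℝ) ^ (d + 1) = 2 ^ d * 2 := pow_succ _ _
    rw [h1]
    nlinarith

/-- Flipping the `i`-th sign permutes the cube and negates every summand. -/
theorem sum_sgn_mul_sgn {d : ℕ} {i j : Fin d} (hij : i ≠ j) :
    ∑ s : Fin d → Bool, sgn (s i) * sgn (s j) = 0 := by
  have h := Equiv.sum_comp
    (Equiv.piCongrRight fun k : Fin d => if k = i then Equiv.boolNot else Equiv.refl Bool)
    (fun s : Fin d → Bool => sgn (s i) * sgn (s j))
  have h2 : ∀ b : Bool, sgn (!b) = -sgn b := by intro b; cases b <;> simp [sgn]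
  simp only [Equiv.piCongrRight_apply, Pi.map_apply, if_true, if_neg hij.symm, Equiv.refl_apply,
    Equiv.boolNot_apply, h2, neg_mul, Finset.sum_neg_distrib] at h
  exact self_eq_neg.mp h.symm

end Moments

/-! ### Coordinates and norms in `ℓ₂X` -/

section L2

variable {X : Type*}

theorem delta_apply_self (x : X) : delta x x = 1 := by
  classical
  simp [delta]

theorem delta_apply_of_ne {x y : X} (h : y ≠ x) : delta x y = 0 := by
  classical
  simp [delta, h]

theorem sum_norm_sq_le (f : L2 X) (s : Finset X) : ∑ x ∈ s, ‖f x‖ ^ 2 ≤ ‖f‖ ^ 2 := by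
  have := lp.sum_rpow_le_norm_rpow (p := 2) (by norm_num) f s
  simpa using this

theorem norm_le_of_forall_sum_norm_sq_le (f : L2 X) {C : ℝ} (hC : 0 ≤ C)
    (h : ∀ s : Finset X, ∑ x ∈ s, ‖f x‖ ^ 2 ≤ C ^ 2) : ‖f‖ ≤ C := by
  refine lp.norm_le_of_forall_sum_le (p := 2) (by norm_num) hC fun s => ?_
  simpa using h s

end L2

/-! ### Rademacher vectors on one block -/

/-- An injective labelling of a finite subset of `X` by `m` copies of the cube `{±1}^d`. -/
structure SignBlock (X : Type*) where
  d : ℕ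
  m : ℕ
  m_pos : 0 < m
  label : (Fin d → Bool) × Fin m ↪ X

namespace SignBlock

variable {X : Type*} (b : SignBlock X)

/-- The labelled points of a block. -/
def supp : Finset X := Finset.univ.map b.label

/-- The number of points of a block. -/
def size : ℕ := 2 ^ b.d * b.m

theorem size_pos : 0 < b.size := Nat.mul_pos (by positivity) b.m_pos

/-- The normalizing factor of the Rademacher vectors of a block. -/
def scale : ℝ := (√(b.size : ℝ))⁻¹

theorem scale_nonneg : 0 ≤ b.scale := inv_nonneg.mpr (Real.sqrt_nonneg _)

theorem scale_sq : b.scale ^ 2 = (b.size : ℝ)⁻¹ := by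
  rw [scale, inv_pow, Real.sq_sqrt (Nat.cast_nonneg _)]

theorem scale_sq_mul_size : b.scale ^ 2 * (2 ^ b.d * b.m) = 1 := by
  rw [scale_sq, size]
  have := b.m_pos
  push_cast
  field_simp

/-- The normalized Rademacher vectors of a block. -/
def vec (i : Fin b.d) : L2 X :=
  ∑ p, ((b.scale : ℂ) * sgn (p.1 i)) • delta (b.label p)

theorem label_mem_supp (p : (Fin b.d → Bool) × Fin b.m) : b.label p ∈ b.supp := by
  simp [supp]

theorem vec_apply_label (i : Fin b.d) (p : (Fin b.d → Bool) × Fin b.m) :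
    b.vec i (b.label p) = b.scale * sgn (p.1 i) := by
  rw [vec, lp.coeFn_sum, Finset.sum_apply, Finset.sum_eq_single p]
  · simp [delta_apply_self]
  · intro q _ hq
    rw [lp.coeFn_smul, Pi.smul_apply, delta_apply_of_ne (by simpa using hq.symm), smul_zero]
  · simp

theorem vec_apply_of_notMem (i : Fin b.d) {x : X} (hx : x ∉ b.supp) : b.vec i x = 0 := by
  rw [vec, lp.coeFn_sum, Finset.sum_apply]
  refine Finset.sum_eq_zero fun p _ => ?_
  rw [lp.coeFn_smul, Pi.smul_apply, delta_apply_of_ne, smul_zero]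
  rintro rfl
  exact hx (b.label_mem_supp p)

theorem inner_vec_left (i : Fin b.d) (f : L2 X) :
    ⟪b.vec i, f⟫_ℂ = ∑ p, b.scale * sgn (p.1 i) * f (b.label p) := by
  rw [vec, sum_inner]
  refine Finset.sum_congr rfl fun p _ => ?_
  rw [inner_smul_left, inner_delta_left, map_mul, Complex.conj_ofReal, starRingEnd_apply, star_sgn]

theorem inner_vec_vec (i j : Fin b.d) : ⟪b.vec i, b.vec j⟫_ℂ = if i = j then 1 else 0 := by
  rw [inner_vec_left]
  have h : ∀ p : (Fin b.d → Bool) × Fin b.m,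
      b.scale * sgn (p.1 i) * b.vec j (b.label p) =
        ((b.scale ^ 2 : ℝ) : ℂ) * (sgn (p.1 i) * sgn (p.1 j)) := by
    intro p
    rw [vec_apply_label]
    push_cast
    ring
  have h' : ∑ p : (Fin b.d → Bool) × Fin b.m, sgn (p.1 i) * sgn (p.1 j) =
      b.m * ∑ s : Fin b.d → Bool, sgn (s i) * sgn (s j) := by
    rw [Fintype.sum_prod_type, Finset.mul_sum]
    simp
  rw [Finset.sum_congr rfl fun p _ => h p, ← Finset.mul_sum, h']
  split_ifs with hij
  · subst hij
    have := b.scale_sq_mul_size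
    simp only [sgn_mul_self, Finset.sum_const, Finset.card_univ, Fintype.card_fun,
      Fintype.card_bool, Fintype.card_fin, nsmul_eq_mul, mul_one]
    rw [mul_comm (b.m : ℂ)]
    exact_mod_cast this
  · rw [sum_sgn_mul_sgn hij, mul_zero, mul_zero]

theorem norm_vec (i : Fin b.d) : ‖b.vec i‖ = 1 := by
  have h2 : ‖b.vec i‖ ^ 2 = 1 := by
    rw [norm_sq_eq_re_inner (𝕜 := ℂ), inner_vec_vec, if_pos rfl, RCLike.one_re]
  exact (pow_eq_one_iff_of_nonneg (norm_nonneg _) two_ne_zero).mp h2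

theorem sum_supp_eq {M : Type*} [AddCommMonoid M] (F : X → M) :
    ∑ x ∈ b.supp, F x = ∑ p, F (b.label p) := by
  rw [supp, Finset.sum_map]

/-- Vectors in the span of the Rademacher vectors are not concentrated on small sets. -/
theorem sum_norm_sq_sq_le_of_mem_span {g : L2 X}
    (hg : g ∈ Submodule.span ℂ (Set.range b.vec)) {s : Finset X} (hs : s ⊆ b.supp) :
    (∑ x ∈ s, ‖g x‖ ^ 2) ^ 2 ≤ 3 * s.card / b.size * (∑ x ∈ b.supp, ‖g x‖ ^ 2) ^ 2 := by
  obtain ⟨c, rfl⟩ := (Submodule.mem_span_range_iff_exists_fun ℂ).mp hg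
  set g : L2 X := ∑ i, c i • b.vec i with hgdef
  have happ : ∀ p, ‖g (b.label p)‖ = b.scale * ‖signSum c p.1‖ := by
    intro p
    have : g (b.label p) = b.scale * signSum c p.1 := by
      rw [hgdef, lp.coeFn_sum, Finset.sum_apply, signSum, Finset.mul_sum]
      refine Finset.sum_congr rfl fun i _ => ?_
      rw [lp.coeFn_smul, Pi.smul_apply, vec_apply_label, smul_eq_mul]
      ring
    rw [this, norm_mul, Complex.norm_real, Real.norm_of_nonneg b.scale_nonneg]
  have h2 : ∑ x ∈ b.supp, ‖g x‖ ^ 2 = ∑ i, ‖c i‖ ^ 2 := by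
    simp only [sum_supp_eq, happ, mul_pow, ← Finset.mul_sum, Fintype.sum_prod_type,
      Finset.sum_const, Finset.card_univ, Fintype.card_fin, nsmul_eq_mul, sum_norm_sq_signSum]
    linear_combination (∑ i, ‖c i‖ ^ 2) * b.scale_sq_mul_size
  have h4 : ∑ x ∈ b.supp, ‖g x‖ ^ 4 ≤ 3 / b.size * (∑ i, ‖c i‖ ^ 2) ^ 2 := by
    simp only [sum_supp_eq, happ, mul_pow, ← Finset.mul_sum, Fintype.sum_prod_type,
      Finset.sum_const, Finset.card_univ, Fintype.card_fin, nsmul_eq_mul]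
    calc b.scale ^ 4 * (b.m * ∑ s, ‖signSum c s‖ ^ 4)
        ≤ b.scale ^ 4 * (b.m * (3 * 2 ^ b.d * (∑ i, ‖c i‖ ^ 2) ^ 2)) := by
          gcongr
          exact sum_norm_pow_four_signSum_le c
      _ = b.scale ^ 2 * (b.scale ^ 2 * (2 ^ b.d * b.m)) * 3 * (∑ i, ‖c i‖ ^ 2) ^ 2 := by ring
      _ = _ := by
          rw [scale_sq_mul_size, scale_sq]
          ring
  -- Cauchy–Schwarz against the constant function on `s` brings in the fourth moment.
  calc (∑ x ∈ s, ‖g x‖ ^ 2) ^ 2 ≤ s.card * ∑ x ∈ s, (‖g x‖ ^ 2) ^ 2 := sq_sum_le_card_mul_sum_sq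
    _ ≤ s.card * ∑ x ∈ b.supp, ‖g x‖ ^ 4 := by
        simp only [← pow_mul]
        gcongr
    _ ≤ s.card * (3 / b.size * (∑ i, ‖c i‖ ^ 2) ^ 2) := by gcongr
    _ = _ := by rw [h2]; ring

end SignBlock

/-! ### Coordinate projections -/

section Projection

variable {X : Type*}

theorem proj_apply_of_mem {A : Set X} (f : L2 X) {x : X} (hx : x ∈ A) : proj A f x = f x := by
  rw [proj_apply, Set.indicator_of_mem hx]

theorem proj_apply_of_notMem {A : Set X} (f : L2 X) {x : X} (hx : x ∉ A) : proj A f x = 0 := by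
  rw [proj_apply, Set.indicator_of_notMem hx]

theorem proj_mul_proj (A B : Set X) : proj A * proj B = proj (A ∩ B) := by
  ext f x
  change A.indicator (B.indicator (f : ∀ _ : X, ℂ)) x = _
  rw [Set.indicator_indicator]
  rfl

theorem proj_eq_self {A : Set X} {f : L2 X} (h : ∀ x ∉ A, f x = 0) : proj A f = f := by
  ext x
  by_cases hx : x ∈ A
  · rw [proj_apply_of_mem f hx]
  · rw [proj_apply_of_notMem f hx, h x hx]

theorem proj_eq_zero {A : Set X} {f : L2 X} (h : ∀ x ∈ A, f x = 0) : proj A f = 0 := by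
  ext x
  by_cases hx : x ∈ A
  · rw [proj_apply_of_mem f hx, h x hx]
    rfl
  · rw [proj_apply_of_notMem f hx]
    rfl

end Projection

/-! ### Projections onto closed spans of Rademacher vectors, and their quasi-locality -/

/-- A family of sign blocks with pairwise disjoint supports. -/
structure BlockFamily (X : Type*) where
  block : ℕ → SignBlock X
  disjoint : ∀ m n, m ≠ n → Disjoint (block m).supp (block n).supp

namespace BlockFamily

variable {X : Type*} (b : BlockFamily X)

/-- The closed span of the Rademacher vectors with label in `J`. -/
def space (J : ∀ n, Set (Fin (b.block n).d)) : Submodule ℂ (L2 X) :=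
  (Submodule.span ℂ {f | ∃ n, ∃ i ∈ J n, f = (b.block n).vec i}).topologicalClosure

variable {b} {J : ∀ n, Set (Fin (b.block n).d)}

instance : CompleteSpace (b.space J) :=
  Submodule.topologicalClosure.completeSpace _

theorem vec_mem_space {n : ℕ} {i : Fin (b.block n).d} (hi : i ∈ J n) :
    (b.block n).vec i ∈ b.space J :=
  Submodule.le_topologicalClosure _ (Submodule.subset_span ⟨n, i, hi, rfl⟩)

theorem space_le {K : Submodule ℂ (L2 X)} (hK : IsClosed (K : Set (L2 X)))
    (h : ∀ n, ∀ i ∈ J n, (b.block n).vec i ∈ K) : b.space J ≤ K := by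
  refine Submodule.topologicalClosure_minimal _ (Submodule.span_le.mpr ?_) hK
  rintro _ ⟨n, i, hi, rfl⟩
  exact h n i hi

theorem notMem_supp {m n : ℕ} (hmn : m ≠ n) {x : X} (hx : x ∈ (b.block m).supp) :
    x ∉ (b.block n).supp :=
  Finset.disjoint_left.mp (b.disjoint m n hmn) hx

theorem vec_mem_orthogonal_space {n : ℕ} {i : Fin (b.block n).d} (hi : i ∉ J n) :
    (b.block n).vec i ∈ (b.space J)ᗮ := by
  rw [Submodule.mem_orthogonal']
  intro f hf
  have hle : b.space J ≤ LinearMap.ker (innerSL ℂ ((b.block n).vec i)).toLinearMap := by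
    refine space_le (ContinuousLinearMap.isClosed_ker _) fun m j hj => ?_
    change ⟪(b.block n).vec i, (b.block m).vec j⟫_ℂ = 0
    by_cases hmn : n = m
    · subst hmn
      rw [SignBlock.inner_vec_vec, if_neg]
      rintro rfl
      exact hi hj
    · rw [SignBlock.inner_vec_left]
      refine Finset.sum_eq_zero fun p _ => ?_
      rw [SignBlock.vec_apply_of_notMem, mul_zero]
      exact notMem_supp hmn ((b.block n).label_mem_supp p)
  exact hle hf

/-- The span on one block is finite-dimensional, hence closed, so the limits in `b.space J` still
restrict to honest linear combinations, to which the fourth moment bound applies. -/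
theorem proj_supp_mem_span {h : L2 X} (hh : h ∈ b.space J) (n : ℕ) :
    proj ((b.block n).supp : Set X) h ∈ Submodule.span ℂ (Set.range (b.block n).vec) := by
  have hle : b.space J ≤ (Submodule.span ℂ (Set.range (b.block n).vec)).comap
      (proj ((b.block n).supp : Set X)).toLinearMap := by
    have := FiniteDimensional.span_of_finite ℂ (Set.finite_range (b.block n).vec)
    have hcl : IsClosed (Submodule.span ℂ (Set.range (b.block n).vec) : Set (L2 X)) :=
      Submodule.closed_of_finiteDimensional _
    refine space_le (hcl.preimage (proj ((b.block n).supp : Set X)).continuous) fun m i _ => ?_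
    change proj ((b.block n).supp : Set X) ((b.block m).vec i) ∈
      Submodule.span ℂ (Set.range (b.block n).vec)
    by_cases hmn : m = n
    · subst hmn
      rw [proj_eq_self fun x hx => SignBlock.vec_apply_of_notMem _ _ (by simpa using hx)]
      exact Submodule.subset_span ⟨i, rfl⟩
    · rw [proj_eq_zero fun x hx => SignBlock.vec_apply_of_notMem _ _
        (notMem_supp (Ne.symm hmn) (by simpa using hx))]
      exact Submodule.zero_mem _
  exact hle hh

theorem apply_eq_zero_of_mem_space {h : L2 X} (hh : h ∈ b.space J) {x : X}
    (hx : ∀ n, x ∉ (b.block n).supp) : h x = 0 := by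
  have hle : b.space J ≤ LinearMap.ker (innerSL ℂ (delta x)).toLinearMap := by
    refine space_le (ContinuousLinearMap.isClosed_ker _) fun m j _ => ?_
    change ⟪delta x, (b.block m).vec j⟫_ℂ = 0
    rw [inner_delta_left, SignBlock.vec_apply_of_notMem _ _ (hx m)]
  have := hle hh
  rw [← inner_delta_left]
  exact this

/-- Cutting down to a union of blocks either keeps or kills each generator. -/
theorem proj_iUnion_supp_mem_space {h : L2 X} (hh : h ∈ b.space J) (G : Set ℕ) :
    proj (⋃ n ∈ G, ((b.block n).supp : Set X)) h ∈ b.space J := by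
  set W : Set X := ⋃ n ∈ G, ((b.block n).supp : Set X) with hW
  have hle : b.space J ≤ (b.space J).comap (proj W).toLinearMap := by
    refine space_le ((Submodule.isClosed_topologicalClosure _).preimage (proj W).continuous)
      fun m i hi => ?_
    change proj W ((b.block m).vec i) ∈ b.space J
    by_cases hm : m ∈ G
    · rw [proj_eq_self fun x hx => SignBlock.vec_apply_of_notMem _ _ fun hx' => hx ?_]
      · exact vec_mem_space hi
      · exact Set.mem_biUnion hm (by simpa using hx')
    · rw [proj_eq_zero fun x hx => SignBlock.vec_apply_of_notMem _ _ ?_]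
      · exact Submodule.zero_mem _
      · obtain ⟨n, hn, hx⟩ := Set.mem_iUnion₂.mp hx
        exact notMem_supp (fun h : n = m => hm (h ▸ hn)) hx
  exact hle hh

/-- Vectors in `b.space J` are not concentrated on sets that are small in every block. -/
theorem norm_proj_le_of_mem_space {h : L2 X} (hh : h ∈ b.space J) {A : Set X} {η : ℝ}
    (hη : 0 ≤ η) (hA : ∀ n, 3 * ((A ∩ (b.block n).supp).ncard : ℝ) ≤ η ^ 4 * (b.block n).size) :
    ‖proj A h‖ ≤ η * ‖h‖ := by
  classical
  have key : ∀ n, ∑ x ∈ (b.block n).supp with x ∈ A, ‖h x‖ ^ 2 ≤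
      η ^ 2 * ∑ x ∈ (b.block n).supp, ‖h x‖ ^ 2 := by
    intro n
    have h1 := (b.block n).sum_norm_sq_sq_le_of_mem_span (proj_supp_mem_span hh n)
      (Finset.filter_subset (· ∈ A) (b.block n).supp)
    have h2 : ∀ s ⊆ (b.block n).supp,
        ∑ x ∈ s, ‖proj ((b.block n).supp : Set X) h x‖ ^ 2 = ∑ x ∈ s, ‖h x‖ ^ 2 := by
      intro s hs
      refine Finset.sum_congr rfl fun x hx => ?_
      rw [proj_apply_of_mem h (by simpa using hs hx)]
    rw [h2 _ (Finset.filter_subset _ _), h2 _ subset_rfl] at h1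
    have h3 : (3 * (((b.block n).supp.filter (· ∈ A)).card : ℝ)) / (b.block n).size ≤ η ^ 4 := by
      have hs : (0 : ℝ) < (b.block n).size := by exact_mod_cast (b.block n).size_pos
      rw [div_le_iff₀ hs]
      refine le_trans (le_of_eq ?_) (hA n)
      rw [← Set.ncard_coe_finset]
      congr 3
      ext x
      simp [and_comm]
    refine le_of_sq_le_sq ?_ (by positivity)
    calc _ ≤ _ := h1
      _ ≤ η ^ 4 * (∑ x ∈ (b.block n).supp, ‖h x‖ ^ 2) ^ 2 := by gcongr
      _ = _ := by ring
  refine norm_le_of_forall_sum_norm_sq_le _ (by positivity) fun s => ?_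
  -- Points outside all blocks may be dropped, since `h` vanishes there.
  set t := s.filter fun x => x ∈ A ∧ ∃ n, x ∈ (b.block n).supp with ht
  have hst : ∑ x ∈ s, ‖proj A h x‖ ^ 2 = ∑ x ∈ t, ‖h x‖ ^ 2 := by
    rw [ht, Finset.sum_filter]
    refine Finset.sum_congr rfl fun x _ => ?_
    split_ifs with hx
    · rw [proj_apply_of_mem h hx.1]
    · by_cases hxA : x ∈ A
      · rw [proj_apply_of_mem h hxA, apply_eq_zero_of_mem_space hh fun n hn => hx ⟨hxA, n, hn⟩]
        simp
      · rw [proj_apply_of_notMem h hxA]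
        simp
  have hchoose : ∀ x : X, ∃ n, x ∈ t → x ∈ (b.block n).supp := by
    intro x
    by_cases hx : x ∈ t
    · obtain ⟨n, hn⟩ := (Finset.mem_filter.mp hx).2.2
      exact ⟨n, fun _ => hn⟩
    -- A default value: the block index of a point outside `t` plays no role.
    · exact ⟨0, fun h => absurd h hx⟩
  choose ν hν using hchoose
  set M := t.image ν
  have hdisj : (M : Set ℕ).PairwiseDisjoint fun n => (b.block n).supp :=
    fun m _ n _ hmn => b.disjoint m n hmn
  have hdisj' : (M : Set ℕ).PairwiseDisjoint fun n => (b.block n).supp.filter (· ∈ A) :=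
    fun m _ n _ hmn => Finset.disjoint_filter_filter (b.disjoint m n hmn)
  rw [hst, mul_pow]
  calc ∑ x ∈ t, ‖h x‖ ^ 2
      ≤ ∑ x ∈ M.biUnion fun n => (b.block n).supp.filter (· ∈ A), ‖h x‖ ^ 2 := by
        refine Finset.sum_le_sum_of_subset_of_nonneg (fun x hx => ?_) fun _ _ _ => by positivity
        rw [Finset.mem_biUnion]
        exact ⟨ν x, Finset.mem_image_of_mem ν hx,
          Finset.mem_filter.mpr ⟨hν x hx, (Finset.mem_filter.mp hx).2.1⟩⟩
    _ = ∑ n ∈ M, ∑ x ∈ (b.block n).supp with x ∈ A, ‖h x‖ ^ 2 := Finset.sum_biUnion hdisj'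
    _ ≤ ∑ n ∈ M, η ^ 2 * ∑ x ∈ (b.block n).supp, ‖h x‖ ^ 2 := Finset.sum_le_sum fun n _ => key n
    _ = η ^ 2 * ∑ x ∈ M.biUnion fun n => (b.block n).supp, ‖h x‖ ^ 2 := by
        rw [← Finset.mul_sum, Finset.sum_biUnion hdisj]
    _ ≤ η ^ 2 * ‖h‖ ^ 2 := by
        gcongr
        exact sum_norm_sq_le h _

variable (b J) in
/-- The orthogonal projection onto `b.space J`. -/
def spaceProj : Op X := (b.space J).starProjection

theorem star_spaceProj : star (b.spaceProj J) = b.spaceProj J :=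
  isSelfAdjoint_starProjection _

theorem norm_proj_mul_spaceProj_le {A : Set X} {η : ℝ} (hη : 0 ≤ η)
    (hA : ∀ n, 3 * ((A ∩ (b.block n).supp).ncard : ℝ) ≤ η ^ 4 * (b.block n).size) :
    ‖proj A * b.spaceProj J‖ ≤ η := by
  refine ContinuousLinearMap.opNorm_le_bound _ hη fun f => ?_
  refine (norm_proj_le_of_mem_space (Submodule.starProjection_apply_mem _ f) hη hA).trans ?_
  gcongr
  exact Submodule.norm_starProjection_apply_le _ f

theorem norm_spaceProj_mul_proj_le {A : Set X} {η : ℝ} (hη : 0 ≤ η)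
    (hA : ∀ n, 3 * ((A ∩ (b.block n).supp).ncard : ℝ) ≤ η ^ 4 * (b.block n).size) :
    ‖b.spaceProj J * proj A‖ ≤ η := by
  rw [← norm_star, star_mul, star_proj, star_spaceProj]
  exact norm_proj_mul_spaceProj_le hη hA

/-- The coordinate projection leaves the range of `b.spaceProj J` invariant, and a self-adjoint
operator that does so commutes with the projection onto that range. -/
theorem proj_iUnion_supp_mul_spaceProj (G : Set ℕ) :
    proj (⋃ n ∈ G, ((b.block n).supp : Set X)) * b.spaceProj J =
      b.spaceProj J * proj (⋃ n ∈ G, ((b.block n).supp : Set X)) := by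
  set W : Set X := ⋃ n ∈ G, ((b.block n).supp : Set X)
  have h : b.spaceProj J * proj W * b.spaceProj J = proj W * b.spaceProj J := by
    ext1 f
    exact Submodule.starProjection_eq_self_iff.mpr
      (proj_iUnion_supp_mem_space (Submodule.starProjection_apply_mem _ f) G)
  have h' := congrArg star h
  simp only [star_mul, star_proj, star_spaceProj, ← mul_assoc] at h'
  rw [← h, h']

/-- Which of `A` and `B` is small may depend on the block. Since the projection commutes with the
cut-off to any union of blocks, the blocks where `A` is small and those where `B` is small can be
treated separately. -/
theorem isQuasiLocal_spaceProj [MetricSpace X]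
    (hmix : ∀ δ : ℝ, 0 < δ → ∃ R : ℝ, 0 < R ∧ ∀ A B : Set X, ENNReal.ofReal R < setDist A B →
      ∀ n, ((A ∩ (b.block n).supp).ncard : ℝ) ≤ δ * (b.block n).size ∨
        ((B ∩ (b.block n).supp).ncard : ℝ) ≤ δ * (b.block n).size) :
    IsQuasiLocal (b.spaceProj J) := by
  intro ε hε
  -- The proportion at which the non-concentration estimate holds with `η = ε / 2`.
  obtain ⟨R, hR, hmix⟩ := hmix ((ε / 2) ^ 4 / 3) (by positivity)
  refine ⟨R, hR, fun A B hAB => ?_⟩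
  set G : Set ℕ :=
    {n | ((A ∩ (b.block n).supp).ncard : ℝ) ≤ (ε / 2) ^ 4 / 3 * (b.block n).size} with hG
  set W : Set X := ⋃ n ∈ G, ((b.block n).supp : Set X) with hW
  have hzero : ∀ n, 0 ≤ (ε / 2) ^ 4 * ((b.block n).size : ℝ) := fun n => by positivity
  have hA : ‖proj (A ∩ W) * b.spaceProj J‖ ≤ ε / 2 := by
    refine norm_proj_mul_spaceProj_le (by positivity) fun n => ?_
    by_cases hn : n ∈ G
    · have h1 : (A ∩ W ∩ (b.block n).supp).ncard ≤ (A ∩ (b.block n).supp).ncard :=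
        Set.ncard_le_ncard (by gcongr; exact Set.inter_subset_left)
          ((Finset.finite_toSet _).inter_of_right A)
      have h2 : ((A ∩ W ∩ (b.block n).supp).ncard : ℝ) ≤ (A ∩ (b.block n).supp).ncard := by
        exact_mod_cast h1
      have h3 : ((A ∩ (b.block n).supp).ncard : ℝ) ≤ _ := hn
      linarith
    · have h1 : A ∩ W ∩ (b.block n).supp = ∅ := by
        refine Set.eq_empty_of_forall_notMem fun x ⟨⟨_, hxW⟩, hx⟩ => ?_
        obtain ⟨m, hm, hxm⟩ := Set.mem_iUnion₂.mp hxW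
        exact notMem_supp (fun h : m = n => hn (h ▸ hm)) hxm hx
      rw [h1]
      simpa using hzero n
  have hB : ‖b.spaceProj J * proj (Wᶜ ∩ B)‖ ≤ ε / 2 := by
    refine norm_spaceProj_mul_proj_le (by positivity) fun n => ?_
    by_cases hn : n ∈ G
    · have h1 : Wᶜ ∩ B ∩ (b.block n).supp = ∅ := by
        refine Set.eq_empty_of_forall_notMem fun x ⟨⟨hxW, _⟩, hx⟩ => hxW ?_
        exact Set.mem_biUnion hn hx
      rw [h1]
      simpa using hzero n
    · have h1 : (Wᶜ ∩ B ∩ (b.block n).supp).ncard ≤ (B ∩ (b.block n).supp).ncard :=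
        Set.ncard_le_ncard (by gcongr; exact Set.inter_subset_right)
          ((Finset.finite_toSet _).inter_of_right B)
      have h2 : ((Wᶜ ∩ B ∩ (b.block n).supp).ncard : ℝ) ≤ (B ∩ (b.block n).supp).ncard := by
        exact_mod_cast h1
      have h3 := (hmix A B hAB n).resolve_left hn
      linarith
  have hsplit : proj A * b.spaceProj J * proj B =
      proj (A ∩ W) * b.spaceProj J * proj B + proj A * (b.spaceProj J * proj (Wᶜ ∩ B)) := by
    have hcomm : proj W * b.spaceProj J = b.spaceProj J * proj W :=
      proj_iUnion_supp_mul_spaceProj G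
    calc proj A * b.spaceProj J * proj B
        = proj A * (b.spaceProj J * (proj W + proj Wᶜ)) * proj B := by
          rw [proj_add_proj_compl, mul_one]
      _ = proj A * (proj W * b.spaceProj J + b.spaceProj J * proj Wᶜ) * proj B := by
          rw [mul_add, hcomm]
      _ = _ := by
          rw [← proj_mul_proj, ← proj_mul_proj]
          noncomm_ring
  calc ‖proj A * b.spaceProj J * proj B‖
      ≤ ‖proj (A ∩ W) * b.spaceProj J‖ * ‖proj B‖ +
          ‖proj A‖ * ‖b.spaceProj J * proj (Wᶜ ∩ B)‖ := by
        rw [hsplit]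
        exact (norm_add_le _ _).trans (add_le_add (norm_mul_le _ _) (norm_mul_le _ _))
    _ ≤ ε / 2 * 1 + 1 * (ε / 2) := by
        gcongr
        · exact norm_proj_le B
        · exact norm_proj_le A
    _ = ε := by ring

end BlockFamily

/-! ### Iterated thickenings in an expander -/

section Expansion

variable {Z : Type*} [MetricSpace Z] {R κ : ℝ}

/-- The closed `R`-neighbourhood of a set. -/
def thicken (R : ℝ) (A : Set Z) : Set Z := {z | Metric.infDist z A ≤ R}

theorem subset_thicken (hR : 0 < R) (A : Set Z) : A ⊆ thicken R A := fun z hz => by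
  rw [thicken, Set.mem_ofPred_eq, Metric.infDist_zero_of_mem hz]
  exact hR.le

theorem nonempty_iterate_thicken (hR : 0 < R) {A : Set Z} (hA : A.Nonempty) (k : ℕ) :
    ((thicken R)^[k] A).Nonempty := by
  induction k with
  | zero => exact hA
  | succ k ih =>
    rw [Function.iterate_succ_apply']
    exact ih.mono (subset_thicken hR _)

variable [Finite Z]

theorem exists_dist_le_of_mem_iterate_thicken (hR : 0 < R) {A : Set Z} (hA : A.Nonempty) (k : ℕ)
    {z : Z} (hz : z ∈ (thicken R)^[k] A) : ∃ a ∈ A, dist z a ≤ k * R := by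
  induction k generalizing z with
  | zero => exact ⟨z, hz, by simp⟩
  | succ k ih =>
    rw [Function.iterate_succ_apply'] at hz
    obtain ⟨y, hy, hzy⟩ := (Set.toFinite ((thicken R)^[k] A)).isCompact.exists_infDist_eq_dist
      (nonempty_iterate_thicken hR hA k) z
    obtain ⟨a, ha, hya⟩ := ih hy
    refine ⟨a, ha, (dist_triangle z y a).trans ?_⟩
    have : Metric.infDist z ((thicken R)^[k] A) ≤ R := hz
    push_cast
    linarith

/-- Thickenings increase, so if the last one fills at most half of the space, then so do all earlier
ones, and each step multiplies the cardinality by at least `κ`. -/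
theorem pow_mul_ncard_le_ncard_iterate_thicken (hR : 0 < R) (hκ : 1 < κ)
    (hexp : ∀ A : Set Z, A.Nonempty → (A.ncard : ℝ) / (Nat.card Z : ℝ) ≤ 1 / 2 →
      κ ≤ ((thicken R A).ncard : ℝ) / (A.ncard : ℝ))
    {A : Set Z} (hA : A.Nonempty) (k : ℕ)
    (hk : (((thicken R)^[k] A).ncard : ℝ) / (Nat.card Z : ℝ) ≤ 1 / 2) :
    κ ^ k * A.ncard ≤ ((thicken R)^[k] A).ncard := by
  induction k with
  | zero => simp
  | succ k ih =>
    rw [Function.iterate_succ_apply'] at hk ⊢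
    set B := (thicken R)^[k] A
    have hB : B.Nonempty := nonempty_iterate_thicken hR hA k
    have hle : (B.ncard : ℝ) ≤ (thicken R B).ncard := by
      exact_mod_cast Set.ncard_le_ncard (subset_thicken hR B) (Set.toFinite _)
    have hB2 : (B.ncard : ℝ) / (Nat.card Z : ℝ) ≤ 1 / 2 := le_trans (by gcongr) hk
    have hpos : (0 : ℝ) < B.ncard := by exact_mod_cast (Set.ncard_pos (Set.toFinite _)).mpr hB
    have h1 := (le_div_iff₀ hpos).mp (hexp B hB hB2)
    calc κ ^ (k + 1) * A.ncard = κ * (κ ^ k * A.ncard) := by ring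
      _ ≤ κ * B.ncard := by gcongr; exact ih hB2
      _ ≤ _ := h1

/-- In an expander, of two distant sets one is small. -/
theorem pow_mul_ncard_le_card_or (hR : 0 < R) (hκ : 1 < κ)
    (hexp : ∀ A : Set Z, A.Nonempty → (A.ncard : ℝ) / (Nat.card Z : ℝ) ≤ 1 / 2 →
      κ ≤ ((thicken R A).ncard : ℝ) / (A.ncard : ℝ))
    {A B : Set Z} (k : ℕ) (hAB : ∀ a ∈ A, ∀ b ∈ B, 2 * k * R < dist a b) :
    κ ^ k * A.ncard ≤ Nat.card Z ∨ κ ^ k * B.ncard ≤ Nat.card Z := by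
  rcases A.eq_empty_or_nonempty with rfl | hA
  · simp
  rcases B.eq_empty_or_nonempty with rfl | hB
  · simp
  have hZ : (0 : ℝ) < Nat.card Z := by
    have : Nonempty Z := ⟨hA.some⟩
    exact_mod_cast Nat.card_pos
  set A' := (thicken R)^[k] A
  set B' := (thicken R)^[k] B
  have hdisj : Disjoint A' B' := by
    refine Set.disjoint_left.mpr fun z hzA hzB => ?_
    obtain ⟨a, ha, hza⟩ := exists_dist_le_of_mem_iterate_thicken hR hA k hzA
    obtain ⟨b, hb, hzb⟩ := exists_dist_le_of_mem_iterate_thicken hR hB k hzB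
    have := hAB a ha b hb
    have := dist_triangle_left a b z
    linarith
  have hsum : (A'.ncard : ℝ) + B'.ncard ≤ Nat.card Z := by
    have := Set.ncard_union_eq hdisj (Set.toFinite _) (Set.toFinite _)
    have h2 := Set.ncard_le_card (A' ∪ B')
    exact_mod_cast this ▸ h2
  have hle : ∀ S : Set Z, (S.ncard : ℝ) ≤ Nat.card Z := fun S => by
    exact_mod_cast Set.ncard_le_card S
  -- The thickenings are disjoint, so the smaller one fills at most half of the space.
  rcases le_total (A'.ncard : ℝ) B'.ncard with h | h
  · left
    refine (pow_mul_ncard_le_ncard_iterate_thicken hR hκ hexp hA k ?_).trans (hle _)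
    rw [div_le_iff₀ hZ]
    linarith
  · right
    refine (pow_mul_ncard_le_ncard_iterate_thicken hR hκ hexp hB k ?_).trans (hle _)
    rw [div_le_iff₀ hZ]
    linarith

end Expansion

/-! ### Pairing operators with signs on one block -/

namespace SignBlock

variable {X : Type*} (b : SignBlock X)

/-- The sums `∑ i, ε i * s i * t i` of a choice `ε` of signs. -/
def kernel (ε : Fin b.d → Bool) (p q : (Fin b.d → Bool) × Fin b.m) : ℂ :=
  ∑ i, sgn (ε i) * (sgn (p.1 i) * sgn (q.1 i))

/-- Expanding in matrix coefficients turns the pairing into an entrywise one with `kernel`, in which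
small propagation becomes visible. -/
theorem sum_sgn_mul_inner_vec (ε : Fin b.d → Bool) (v : Op X) :
    ∑ i, sgn (ε i) * ⟪b.vec i, v (b.vec i)⟫_ℂ =
      ∑ p, ∑ q, (b.scale : ℂ) ^ 2 * (b.kernel ε p q * v (delta (b.label q)) (b.label p)) := by
  have h : ∀ i, sgn (ε i) * ⟪b.vec i, v (b.vec i)⟫_ℂ = ∑ p, ∑ q, (b.scale : ℂ) ^ 2 *
      ((sgn (ε i) * (sgn (p.1 i) * sgn (q.1 i))) * v (delta (b.label q)) (b.label p)) := by
    intro i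
    rw [inner_vec_left, Finset.mul_sum]
    refine Finset.sum_congr rfl fun p _ => ?_
    conv_lhs => rw [vec]
    rw [map_sum, lp.coeFn_sum, Finset.sum_apply, Finset.mul_sum, Finset.mul_sum]
    refine Finset.sum_congr rfl fun q _ => ?_
    rw [map_smul, lp.coeFn_smul, Pi.smul_apply, smul_eq_mul]
    ring
  simp only [h, kernel]
  rw [Finset.sum_comm]
  refine Finset.sum_congr rfl fun p _ => ?_
  rw [Finset.sum_comm]
  refine Finset.sum_congr rfl fun q _ => ?_
  rw [← Finset.mul_sum, Finset.sum_mul]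

variable [MetricSpace X]

open scoped Classical in
/-- The pairs of labels of points at distance at most `r`. -/
def near (r : ℝ) : Finset (((Fin b.d → Bool) × Fin b.m) × ((Fin b.d → Bool) × Fin b.m)) :=
  {z | dist (b.label z.2) (b.label z.1) ≤ r}

theorem card_near_le {r : ℝ} {K : ℕ}
    (hK : ∀ x : X, (Metric.closedBall x r).encard ≤ (K : ℕ∞)) :
    (b.near r).card ≤ b.size * K := by
  classical
  have h : ∀ q ∈ (Finset.univ : Finset ((Fin b.d → Bool) × Fin b.m)),
      ((b.near r).filter fun z => z.2 = q).card ≤ K := by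
    intro q _
    have h1 : (((b.near r).filter fun z => z.2 = q).image fun z => b.label z.1).card =
        ((b.near r).filter fun z => z.2 = q).card := by
      refine Finset.card_image_of_injOn fun z hz w hw hzw => ?_
      have hz2 : z.2 = q := (Finset.mem_filter.mp hz).2
      have hw2 : w.2 = q := (Finset.mem_filter.mp hw).2
      exact Prod.ext (b.label.injective hzw) (hz2.trans hw2.symm)
    have h2 : ((((b.near r).filter fun z => z.2 = q).image fun z => b.label z.1 :
        Finset X) : Set X) ⊆ Metric.closedBall (b.label q) r := by
      intro x hx
      obtain ⟨z, hz, rfl⟩ := Finset.mem_image.mp (Finset.mem_coe.mp hx)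
      obtain ⟨hz1, rfl⟩ := Finset.mem_filter.mp hz
      rw [Metric.mem_closedBall, dist_comm]
      simpa [near] using hz1
    have h3 := (Set.encard_le_encard h2).trans (hK _)
    rw [Set.encard_coe_eq_coe_finsetCard, h1] at h3
    exact_mod_cast h3
  refine (Finset.card_le_mul_card_image_of_maps_to
    (fun z _ => Finset.mem_univ z.2) K h).trans (le_of_eq ?_)
  simp [size, mul_comm]

/-- A suitable choice of signs makes the kernel small near the diagonal. -/
theorem exists_sum_near_kernel_le {r : ℝ} {K : ℕ}
    (hK : ∀ x : X, (Metric.closedBall x r).encard ≤ (K : ℕ∞)) :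
    ∃ ε, ∑ z ∈ b.near r, ‖b.kernel ε z.1 z.2‖ ^ 2 ≤ b.size * K * b.d := by
  have hsum : ∑ ε, ∑ z ∈ b.near r, ‖b.kernel ε z.1 z.2‖ ^ 2 ≤
      ∑ _ε : Fin b.d → Bool, (b.size * K * b.d : ℝ) := by
    rw [Finset.sum_comm]
    -- For a fixed pair of labels the kernel is a random sign sum in `ε` with `d` unimodular
    -- coefficients, so its mean square is `d`.
    have h : ∀ z ∈ b.near r, ∑ ε, ‖b.kernel ε z.1 z.2‖ ^ 2 = 2 ^ b.d * (b.d : ℝ) := by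
      intro z _
      have h1 : ∀ ε, b.kernel ε z.1 z.2 =
          signSum (fun i => sgn (z.1.1 i) * sgn (z.2.1 i)) ε := fun ε =>
        Finset.sum_congr rfl fun i _ => mul_comm _ _
      simp only [h1, sum_norm_sq_signSum, norm_mul, norm_sgn]
      simp
    rw [Finset.sum_congr rfl h]
    have h2 : ((b.near r).card : ℝ) ≤ b.size * K := by exact_mod_cast b.card_near_le hK
    simp only [Finset.sum_const, nsmul_eq_mul, Finset.card_univ, Fintype.card_fun,
      Fintype.card_bool, Fintype.card_fin]
    push_cast
    calc ((b.near r).card : ℝ) * (2 ^ b.d * b.d) ≤ (b.size * K) * (2 ^ b.d * b.d) := by gcongr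
      _ = _ := by ring
  obtain ⟨ε, _, h⟩ := Finset.exists_le_of_sum_le Finset.univ_nonempty hsum
  exact ⟨ε, h⟩

/-- Operators of small propagation pair weakly with a sign choice whose kernel is small near the
diagonal. -/
theorem norm_sum_sgn_mul_inner_vec_sq_le {r : ℝ} {K : ℕ} {ε : Fin b.d → Bool}
    (hε : ∑ z ∈ b.near r, ‖b.kernel ε z.1 z.2‖ ^ 2 ≤ b.size * K * b.d)
    {v : Op X} (hv : PropagationLE r v) :
    ‖∑ i, sgn (ε i) * ⟪b.vec i, v (b.vec i)⟫_ℂ‖ ^ 2 ≤ K * b.d * ‖v‖ ^ 2 := by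
  classical
  set V : ((Fin b.d → Bool) × Fin b.m) × ((Fin b.d → Bool) × Fin b.m) → ℂ :=
    fun z => v (delta (b.label z.2)) (b.label z.1) with hV
  have hV0 : ∀ z ∉ b.near r, V z = 0 := by
    intro z hz
    have h1 : r < dist (b.label z.2) (b.label z.1) := by simpa [near] using hz
    have h2 := hv _ _ h1
    rw [inner_delta_right] at h2
    exact star_eq_zero.mp h2
  -- A Hilbert–Schmidt bound: each of the `size` columns has norm at most `‖v‖`.
  have hV2 : ∑ z ∈ b.near r, ‖V z‖ ^ 2 ≤ b.size * ‖v‖ ^ 2 := by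
    calc ∑ z ∈ b.near r, ‖V z‖ ^ 2 ≤ ∑ z, ‖V z‖ ^ 2 :=
          Finset.sum_le_sum_of_subset_of_nonneg (Finset.subset_univ _) fun _ _ _ => by positivity
      _ = ∑ q, ∑ x ∈ b.supp, ‖v (delta (b.label q)) x‖ ^ 2 := by
          rw [Fintype.sum_prod_type_right]
          refine Finset.sum_congr rfl fun q _ => ?_
          rw [sum_supp_eq]
      _ ≤ ∑ _q : (Fin b.d → Bool) × Fin b.m, ‖v‖ ^ 2 := by
          refine Finset.sum_le_sum fun q _ => (sum_norm_sq_le _ _).trans ?_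
          gcongr
          refine (v.le_opNorm _).trans (le_of_eq ?_)
          rw [delta, lp.norm_single (by norm_num)]
          simp
      _ = b.size * ‖v‖ ^ 2 := by simp [size]
  have heq : ∑ i, sgn (ε i) * ⟪b.vec i, v (b.vec i)⟫_ℂ =
      (b.scale : ℂ) ^ 2 * ∑ z ∈ b.near r, b.kernel ε z.1 z.2 * V z := by
    rw [sum_sgn_mul_inner_vec, ← Fintype.sum_prod_type', Finset.mul_sum]
    refine (Finset.sum_subset (Finset.subset_univ _) fun z _ hz => ?_).symm
    change (b.scale : ℂ) ^ 2 * (b.kernel ε z.1 z.2 * V z) = 0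
    rw [hV0 z hz, mul_zero, mul_zero]
  have hle : ‖∑ z ∈ b.near r, b.kernel ε z.1 z.2 * V z‖ ≤
      ∑ z ∈ b.near r, ‖b.kernel ε z.1 z.2‖ * ‖V z‖ := by
    refine (norm_sum_le _ _).trans (le_of_eq ?_)
    simp only [norm_mul]
  have hs : b.scale ^ 2 * b.size = 1 := by
    rw [scale_sq, inv_mul_cancel₀]
    exact_mod_cast b.size_pos.ne'
  rw [heq, norm_mul, norm_pow, Complex.norm_real, Real.norm_of_nonneg b.scale_nonneg]
  calc (b.scale ^ 2 * ‖∑ z ∈ b.near r, b.kernel ε z.1 z.2 * V z‖) ^ 2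
      ≤ (b.scale ^ 2 * ∑ z ∈ b.near r, ‖b.kernel ε z.1 z.2‖ * ‖V z‖) ^ 2 := by gcongr
    _ = (b.scale ^ 2) ^ 2 * (∑ z ∈ b.near r, ‖b.kernel ε z.1 z.2‖ * ‖V z‖) ^ 2 := mul_pow _ _ _
    _ ≤ (b.scale ^ 2) ^ 2 * ((∑ z ∈ b.near r, ‖b.kernel ε z.1 z.2‖ ^ 2) *
          ∑ z ∈ b.near r, ‖V z‖ ^ 2) := by
        gcongr
        exact Finset.sum_mul_sq_le_sq_mul_sq _ _ _
    -- The two factors `size` cancel the normalization, so the final bound does not depend on the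
    -- size of the block.
    _ ≤ (b.scale ^ 2) ^ 2 * ((b.size * K * b.d) * (b.size * ‖v‖ ^ 2)) := by gcongr
    _ = (b.scale ^ 2 * b.size) ^ 2 * (K * b.d * ‖v‖ ^ 2) := by ring
    _ = K * b.d * ‖v‖ ^ 2 := by rw [hs, one_pow, one_mul]

end SignBlock

/-! ### The uniform Roe algebra lies in the quasi-local algebra -/

section Inclusion

variable {X : Type*} [MetricSpace X]

theorem dist_gt_of_lt_setDist {A B : Set X} {r : ℝ} (hr : 0 ≤ r)
    (h : ENNReal.ofReal r < setDist A B) {a b : X} (ha : a ∈ A) (hb : b ∈ B) : r < dist a b := by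
  have h1 := h.trans_le (setDist_le ha hb)
  rwa [edist_dist, ENNReal.ofReal_lt_ofReal_iff_of_nonneg hr] at h1

theorem PropagationLE.proj_mul_mul_proj_eq_zero {R : ℝ} {u : Op X} (hu : PropagationLE R u)
    {A B : Set X} (hAB : ∀ a ∈ A, ∀ b ∈ B, R < dist a b) : proj A * u * proj B = 0 := by
  ext1 f
  refine proj_eq_zero fun y hy => ?_
  change u (proj B f) y = 0
  rw [← inner_delta_left, ← ContinuousLinearMap.adjoint_inner_left, lp.inner_eq_tsum]
  refine (tsum_congr fun z => ?_).trans tsum_zero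
  by_cases hz : z ∈ B
  · have h := hu.star y z (hAB y hy z hz)
    rw [inner_delta_right, ContinuousLinearMap.star_eq_adjoint] at h
    rw [star_eq_zero.mp h, inner_zero_left]
  · rw [proj_apply_of_notMem f hz, inner_zero_right]

theorem HasFinitePropagation.isQuasiLocal {u : Op X} (hu : HasFinitePropagation u) :
    IsQuasiLocal u := by
  obtain ⟨R, hR, hu⟩ := hu
  refine fun ε hε => ⟨R, hR, fun A B hAB => ?_⟩
  rw [hu.proj_mul_mul_proj_eq_zero fun a ha b hb => dist_gt_of_lt_setDist hR.le hAB ha hb,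
    norm_zero]
  exact hε.le

theorem isQuasiLocal_of_mem_closure {u : Op X} (hu : u ∈ closure {v : Op X | IsQuasiLocal v}) :
    IsQuasiLocal u := by
  intro ε hε
  obtain ⟨v, hv, huv⟩ := Metric.mem_closure_iff.mp hu (ε / 2) (by positivity)
  obtain ⟨R, hR, hv⟩ := hv (ε / 2) (by positivity)
  refine ⟨R, hR, fun A B hAB => ?_⟩
  have hsplit : proj A * u * proj B = proj A * (u - v) * proj B + proj A * v * proj B := by
    noncomm_ring
  rw [dist_eq_norm] at huv
  calc ‖proj A * u * proj B‖ ≤ ‖proj A‖ * ‖u - v‖ * ‖proj B‖ + ‖proj A * v * proj B‖ := by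
        rw [hsplit]
        exact (norm_add_le _ _).trans (by gcongr; exact norm_mul₃_le)
    _ ≤ 1 * (ε / 2) * 1 + ε / 2 := by
        gcongr
        · exact norm_proj_le A
        · exact norm_proj_le B
        · exact hv A B hAB
    _ = ε := by ring

theorem uniformRoeAlgebra_le_quasiLocalAlgebra :
    uniformRoeAlgebra X ≤ quasiLocalAlgebra X := fun _ hu =>
  isQuasiLocal_of_mem_closure (closure_mono (fun _ hv => HasFinitePropagation.isQuasiLocal hv) hu)

end Inclusion

/-! ### The sign operator and its distance to finite propagation operators -/

namespace BlockFamily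

variable {X : Type*} (b : BlockFamily X)

/-- The operator that multiplies each Rademacher vector by a sign. -/
def signOp (ε : ∀ n, Fin (b.block n).d → Bool) : Op X :=
  b.spaceProj (fun n => {i | ε n i = true}) - b.spaceProj (fun n => {i | ε n i = false})

variable {b}

theorem spaceProj_vec_of_mem {J : ∀ n, Set (Fin (b.block n).d)} {n : ℕ}
    {i : Fin (b.block n).d} (hi : i ∈ J n) :
    b.spaceProj J ((b.block n).vec i) = (b.block n).vec i :=
  Submodule.starProjection_eq_self_iff.mpr (vec_mem_space hi)

theorem spaceProj_vec_of_notMem {J : ∀ n, Set (Fin (b.block n).d)} {n : ℕ}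
    {i : Fin (b.block n).d} (hi : i ∉ J n) : b.spaceProj J ((b.block n).vec i) = 0 :=
  (Submodule.starProjection_apply_eq_zero_iff _).mpr (vec_mem_orthogonal_space hi)

theorem signOp_vec (ε : ∀ n, Fin (b.block n).d → Bool) (n : ℕ) (i : Fin (b.block n).d) :
    b.signOp ε ((b.block n).vec i) = sgn (ε n i) • (b.block n).vec i := by
  rw [signOp, sub_apply]
  cases h : ε n i
  · rw [spaceProj_vec_of_notMem (by simp [h]), spaceProj_vec_of_mem (by simpa using h)]
    simp [sgn]
  · rw [spaceProj_vec_of_mem (by simpa using h), spaceProj_vec_of_notMem (by simp [h])]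
    simp [sgn]

theorem isQuasiLocal_signOp [MetricSpace X] (ε : ∀ n, Fin (b.block n).d → Bool)
    (hmix : ∀ δ : ℝ, 0 < δ → ∃ R : ℝ, 0 < R ∧ ∀ A B : Set X, ENNReal.ofReal R < setDist A B →
      ∀ n, ((A ∩ (b.block n).supp).ncard : ℝ) ≤ δ * (b.block n).size ∨
        ((B ∩ (b.block n).supp).ncard : ℝ) ≤ δ * (b.block n).size) :
    IsQuasiLocal (b.signOp ε) :=
  sub_mem (show b.spaceProj _ ∈ quasiLocalAlgebra X from isQuasiLocal_spaceProj hmix)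
    (show b.spaceProj _ ∈ quasiLocalAlgebra X from isQuasiLocal_spaceProj hmix)

/-- The pairing with the signs is `d` for `signOp`, at most `d / 2` in modulus for the difference,
and at most `√(K * d) * ‖v‖` for `v`; compare and divide by `d`. -/
theorem card_le_of_norm_signOp_sub_lt [MetricSpace X] {ε : ∀ n, Fin (b.block n).d → Bool}
    {n : ℕ} {r : ℝ} {K : ℕ}
    (hε : ∑ z ∈ (b.block n).near r, ‖(b.block n).kernel (ε n) z.1 z.2‖ ^ 2 ≤
      (b.block n).size * K * (b.block n).d)
    {v : Op X} (hv : PropagationLE r v) (huv : ‖b.signOp ε - v‖ ≤ 1 / 2) :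
    ((b.block n).d : ℝ) ≤ 4 * K * ‖v‖ ^ 2 := by
  set c := b.block n
  have hsum : ∑ i, sgn (ε n i) * ⟪c.vec i, b.signOp ε (c.vec i)⟫_ℂ = c.d := by
    have : ∀ i, sgn (ε n i) * ⟪c.vec i, b.signOp ε (c.vec i)⟫_ℂ = 1 := by
      intro i
      rw [signOp_vec, inner_smul_right, SignBlock.inner_vec_vec, if_pos rfl, mul_one,
        sgn_mul_self]
    simp [this, c]
  have hdiff : ‖∑ i, sgn (ε n i) * ⟪c.vec i, (b.signOp ε - v) (c.vec i)⟫_ℂ‖ ≤ c.d * (1 / 2) := by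
    refine (norm_sum_le _ _).trans ((Finset.sum_le_sum (g := fun _ => 1 / 2) fun i _ => ?_).trans
      (le_of_eq (by simp [c])))
    rw [norm_mul, norm_sgn, one_mul]
    calc _ ≤ ‖c.vec i‖ * ‖(b.signOp ε - v) (c.vec i)‖ := norm_inner_le_norm _ _
      _ ≤ ‖c.vec i‖ * (‖b.signOp ε - v‖ * ‖c.vec i‖) := by
          gcongr
          exact ContinuousLinearMap.le_opNorm _ _
      _ ≤ 1 / 2 := by
          rw [SignBlock.norm_vec]
          linarith
  have hadd : (c.d : ℂ) = ∑ i, sgn (ε n i) * ⟪c.vec i, (b.signOp ε - v) (c.vec i)⟫_ℂ +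
      ∑ i, sgn (ε n i) * ⟪c.vec i, v (c.vec i)⟫_ℂ := by
    rw [← hsum, ← Finset.sum_add_distrib]
    refine Finset.sum_congr rfl fun i _ => ?_
    rw [sub_apply, inner_sub_right]
    ring
  have hnorm := (congrArg norm hadd).trans_le (norm_add_le _ _)
  rw [Complex.norm_natCast] at hnorm
  have hv2 := c.norm_sum_sgn_mul_inner_vec_sq_le hε hv
  set s := ‖∑ i, sgn (ε n i) * ⟪c.vec i, v (c.vec i)⟫_ℂ‖
  rcases Nat.eq_zero_or_pos c.d with h0 | hpos
  · rw [h0]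
    push_cast
    positivity
  have hpos : (0 : ℝ) < c.d := by exact_mod_cast hpos
  have hs : (c.d : ℝ) / 2 ≤ s := by linarith
  have hs2 : ((c.d : ℝ) / 2) ^ 2 ≤ K * c.d * ‖v‖ ^ 2 := le_trans (by gcongr) hv2
  refine le_of_mul_le_mul_right ?_ hpos
  linarith

end BlockFamily

/-! ### Choice of blocks and conclusion -/

section Construction

variable {X : Type*}

/-- Removing the forbidden set `U` and then fewer than `2 ^ d` further points leaves a multiple of
`2 ^ d`; the hypothesis says that this costs at most half of `Y`. -/
theorem SignBlock.exists_of_card_le {Y U : Finset X} {d : ℕ}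
    (h : 2 * (2 ^ d + U.card) ≤ Y.card) (hY : 0 < Y.card) :
    ∃ b : SignBlock X, b.d = d ∧ b.supp ⊆ Y ∧ Disjoint U b.supp ∧ Y.card ≤ 2 * b.size := by
  classical
  have hcard : Y.card - U.card ≤ (Y \ U).card := Finset.le_card_sdiff U Y
  set m := (Y \ U).card / 2 ^ d with hm
  have h2 : 0 < 2 ^ d := by positivity
  have hm1 : 2 ^ d * m ≤ (Y \ U).card := Nat.mul_div_le _ _
  have hm2 : (Y \ U).card < 2 ^ d * m + 2 ^ d := by
    have := Nat.div_add_mod (Y \ U).card (2 ^ d)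
    rw [← hm] at this
    have := Nat.mod_lt (Y \ U).card h2
    omega
  have hmpos : 0 < m := by
    refine Nat.div_pos ?_ h2
    omega
  have hemb : Fintype.card ((Fin d → Bool) × Fin m) ≤ Fintype.card {x // x ∈ Y \ U} := by
    simpa using hm1
  obtain ⟨φ⟩ := Function.Embedding.nonempty_of_card_le hemb
  have hsupp : ∀ x ∈ (SignBlock.mk d m hmpos (φ.trans (Function.Embedding.subtype _))).supp,
      x ∈ Y \ U := by
    intro x hx
    obtain ⟨p, _, rfl⟩ := Finset.mem_map.mp hx
    exact (φ p).2
  refine ⟨⟨d, m, hmpos, φ.trans (Function.Embedding.subtype _)⟩, rfl,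
    fun x hx => (Finset.mem_sdiff.mp (hsupp x hx)).1,
    Finset.disjoint_right.mpr fun x hx => (Finset.mem_sdiff.mp (hsupp x hx)).2, ?_⟩
  change Y.card ≤ 2 * (2 ^ d * m)
  omega

/-- Disjoint blocks with prescribed dimensions inside a sequence of growing finite sets. -/
theorem BlockFamily.exists_of_tendsto {Y : ℕ → Finset X}
    (hY : Filter.Tendsto (fun n => (Y n).card) Filter.atTop Filter.atTop) (D : ℕ → ℕ) :
    ∃ (b : BlockFamily X) (ℓ : ℕ → ℕ), (∀ n, n ≤ ℓ n) ∧ ∀ n, (b.block n).d = D (ℓ n) ∧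
      ∃ k, (b.block n).supp ⊆ Y k ∧ (Y k).card ≤ 2 * (b.block n).size := by
  classical
  -- Each block carries an index `ℓ` prescribing its dimension. The recursion asks for an index
  -- above all earlier ones and for a block avoiding all points already used.
  obtain ⟨f, hf, hlt⟩ := exists_seq_of_forall_finset_exists
    (fun z : ℕ × SignBlock X => z.2.d = D z.1 ∧
      ∃ k, z.2.supp ⊆ Y k ∧ (Y k).card ≤ 2 * z.2.size)
    (fun z w => z.1 < w.1 ∧ Disjoint z.2.supp w.2.supp) (fun s _ => by
      set ℓ := s.sup Prod.fst + 1
      set U := s.biUnion fun z => z.2.supp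
      obtain ⟨k, hk⟩ := (hY.eventually_ge_atTop (2 * (2 ^ D ℓ + U.card))).exists
      have h2 : 0 < 2 ^ D ℓ := by positivity
      obtain ⟨c, hcd, hcY, hcU, hc⟩ := SignBlock.exists_of_card_le hk (by omega)
      refine ⟨(ℓ, c), ⟨hcd, k, hcY, hc⟩, fun z hz => ⟨?_, ?_⟩⟩
      · exact Nat.lt_succ_of_le (Finset.le_sup (f := Prod.fst) hz)
      · exact hcU.mono_left (Finset.subset_biUnion_of_mem (fun z => z.2.supp) hz))
  have hmono : StrictMono fun n => (f n).1 := fun m n hmn => (hlt m n hmn).1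
  refine ⟨⟨fun n => (f n).2, fun m n hmn => ?_⟩, fun n => (f n).1, fun n => hmono.le_apply, hf⟩
  rcases lt_or_gt_of_ne hmn with h | h
  · exact (hlt m n h).2
  · exact (hlt n m h).2.symm

theorem BlockFamily.mixing_of_expanders [MetricSpace X] {b : BlockFamily X} {Y : ℕ → Finset X}
    (hY : IsExpanderSequence fun n => {x : X // x ∈ Y n})
    (hb : ∀ n, ∃ k, (b.block n).supp ⊆ Y k ∧ (Y k).card ≤ 2 * (b.block n).size)
    {δ : ℝ} (hδ : 0 < δ) :
    ∃ R : ℝ, 0 < R ∧ ∀ A B : Set X, ENNReal.ofReal R < setDist A B →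
      ∀ n, ((A ∩ (b.block n).supp).ncard : ℝ) ≤ δ * (b.block n).size ∨
        ((B ∩ (b.block n).supp).ncard : ℝ) ≤ δ * (b.block n).size := by
  obtain ⟨-, R, hR, κ, hκ, hexp⟩ := hY
  -- The factor `2` pays for the block filling only half of `Y j`.
  obtain ⟨k, hk⟩ := pow_unbounded_of_one_lt (2 / δ) hκ
  -- The summand `1` keeps the radius positive when `k = 0`.
  refine ⟨2 * k * R + 1, by positivity, fun A B hAB n => ?_⟩
  obtain ⟨j, hsub, hcard⟩ := hb n
  have hcard' : ((Y j).card : ℝ) ≤ 2 * (b.block n).size := by exact_mod_cast hcard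
  have hle : ∀ S : Set X, κ ^ k * ((↑) ⁻¹' S : Set {x // x ∈ Y j}).ncard ≤
      Nat.card {x // x ∈ Y j} → ((S ∩ (b.block n).supp).ncard : ℝ) ≤ δ * (b.block n).size := by
    intro S hS
    have h1 : (S ∩ (b.block n).supp).ncard ≤ ((↑) ⁻¹' S : Set {x // x ∈ Y j}).ncard := by
      rw [← Set.ncard_image_of_injective _ Subtype.val_injective]
      refine Set.ncard_le_ncard (fun x hx => ?_) (Set.toFinite _)
      exact ⟨⟨x, hsub (by simpa using hx.2)⟩, hx.1, rfl⟩
    have h2 : ((S ∩ (b.block n).supp).ncard : ℝ) ≤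
        ((↑) ⁻¹' S : Set {x // x ∈ Y j}).ncard := by exact_mod_cast h1
    rw [Nat.card_eq_fintype_card, Fintype.card_coe] at hS
    set N : ℝ := (((↑) ⁻¹' S : Set {x // x ∈ Y j}).ncard : ℝ)
    have h3 : 2 / δ * N ≤ 2 * (b.block n).size :=
      le_trans (by gcongr) (hS.trans hcard')
    have h4 : N ≤ δ * (b.block n).size := by
      have : N = δ / 2 * (2 / δ * N) := by field_simp
      rw [this]
      calc _ ≤ δ / 2 * (2 * (b.block n).size) := by gcongr
        _ = _ := by ring
    exact h2.trans h4
  refine (pow_mul_ncard_le_card_or (Z := {x // x ∈ Y j}) hR hκ (hexp j) k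
    fun x hx y hy => ?_).imp (hle A) (hle B)
  have := dist_gt_of_lt_setDist (by positivity) hAB hx hy
  rw [Subtype.dist_eq]
  linarith

theorem exists_isQuasiLocal_notMem_closure [MetricSpace X] (hX : IsULF X)
    (hexp : ContainsExpanders X) :
    ∃ u : Op X, IsQuasiLocal u ∧ u ∉ closure {v : Op X | HasFinitePropagation v} := by
  obtain ⟨Y, hY⟩ := hexp
  have hcard : Filter.Tendsto (fun n => (Y n).card) Filter.atTop Filter.atTop := by
    simpa using hY.1
  have hK : ∀ n : ℕ, ∃ K : ℕ, ∀ x : X,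
      (Metric.closedBall x ((n : ℝ) + 1)).encard ≤ (K : ℕ∞) := fun n => hX _ (by positivity)
  choose K hK using hK
  -- With `d = ℓ * K ℓ + 1`, the bound `d ≤ 4 * K ℓ * ‖v‖ ^ 2` fails as soon as `ℓ ≥ 4 * ‖v‖ ^ 2`;
  -- the `+ 1` makes this strict even if `K ℓ = 0`.
  obtain ⟨b, ℓ, hℓ, hb⟩ :=
    BlockFamily.exists_of_tendsto hcard fun n => n * K n + 1
  choose ε hε using fun n => (b.block n).exists_sum_near_kernel_le (hK (ℓ n))
  refine ⟨b.signOp ε, BlockFamily.isQuasiLocal_signOp ε fun δ hδ =>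
    BlockFamily.mixing_of_expanders hY (fun n => (hb n).2) hδ, fun hmem => ?_⟩
  obtain ⟨v, ⟨r, _, hv⟩, huv⟩ := Metric.mem_closure_iff.mp hmem (1 / 2) (by norm_num)
  -- The block must handle the propagation `r` and have a dimension too large for `‖v‖`; both follow
  -- from `n ≤ ℓ n`.
  obtain ⟨n, hn⟩ := exists_nat_ge (max r (4 * ‖v‖ ^ 2))
  have hn' : max r (4 * ‖v‖ ^ 2) ≤ ℓ n := hn.trans (by exact_mod_cast hℓ n)
  have hr : r ≤ ℓ n + 1 := ((le_max_left _ _).trans hn').trans (by linarith)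
  rw [dist_eq_norm] at huv
  have h := BlockFamily.card_le_of_norm_signOp_sub_lt (hε n) (hv.mono hr) huv.le
  rw [(hb n).1] at h
  push_cast at h
  have h4 : 4 * ‖v‖ ^ 2 ≤ ℓ n := (le_max_right _ _).trans hn'
  have h5 : (K (ℓ n) : ℝ) * (4 * ‖v‖ ^ 2) ≤ K (ℓ n) * ℓ n := by gcongr
  linarith

end Construction

end

end RoeAlgebra


theorem corollaryC {X : Type*} [MetricSpace X] (hX : RoeAlgebra.IsULF X)
    (hexp : RoeAlgebra.ContainsExpanders X) :
    RoeAlgebra.uniformRoeAlgebra X < RoeAlgebra.quasiLocalAlgebra X ∧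
      ∃ u : RoeAlgebra.Op X, RoeAlgebra.IsQuasiLocal u ∧
        u ∉ closure {v : RoeAlgebra.Op X | RoeAlgebra.HasFinitePropagation v} := by
  obtain ⟨u, hu, hnot⟩ := RoeAlgebra.exists_isQuasiLocal_notMem_closure hX hexp
  exact ⟨lt_of_le_not_ge RoeAlgebra.uniformRoeAlgebra_le_quasiLocalAlgebra
    fun hle => hnot (hle hu), u, hu, hnot⟩
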